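/- Let $d\ge 1$ be an integer and $\alpha\in(0,1)$. Let $\mathbb B$ be the regular rooted $d$-ary tree (every vertex has exactly $d$ children), let $|x|$ denote the generation of a vertex $x$ (the root $0$ has $|0|=0$), and write $y\le x$ if $y$ is an ancestor of $x$ or $y=x$. Let $(U_x)_{x\in\mathbb B}$ be i.i.d. exponential random variables with mean $1$ on a probability space, and for $x\in\mathbb B$, $t\ge 0$ put $$T(x)=\sum_{y\le x}\alpha^{|y|}U_y,\qquad C(t)=\{x\in\mathbb B: T(x)\le t\},\qquad T(\infty)=\lim_{n\to\infty}\inf\{t\ge 0:\#C(t)=n\},$$ where the limit exists almost surely. Then $\mathbb P(T(\infty)>t)>0$ for every $t\ge0$, and there is a constant $c_{4.8}(\alpha,d)\in(0,\infty)$, depending only on $\alpha$ and $d$, such that $$\mathbb E\big(\#C(t)^2\,\big|\,T(\infty)>t\big)\le c_{4.8}(\alpha,d)\qquad\text{for all } t\ge 0.$$ -/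

import Mathlib

open MeasureTheory ProbabilityTheory Filter
open scoped NNReal ENNReal ProbabilityTheory

namespace TreeDLA

/-- The vertices of the regular `d`-ary tree: finite words in `d` letters. The empty word is the
root, the length of a word `x` is its generation `|x|`, the children of `x` are the words
`x ++ [i]`, and the ancestors of `x` (including `x` itself) are its prefixes `x.take k`
with `k ≤ |x|`. -/
abbrev Vertex (d : ℕ) : Type := List (Fin d)

variable {d : ℕ}

/-- The passage time `T(x) = ∑_{y ≤ x} α ^ |y| * u y`, the sum being over all ancestors `y` of `x`,
including `x` itself and the root. -/
noncomputable def passageTime (α : ℝ) (u : Vertex d → ℝ) (x : Vertex d) : ℝ :=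
  ∑ k ∈ Finset.range (x.length + 1), α ^ k * u (x.take k)

/-- The cluster `C(t)` of the vertices that are wet at time `t`. -/
def cluster (α : ℝ) (u : Vertex d → ℝ) (t : ℝ) : Set (Vertex d) :=
  {x | passageTime α u x ≤ t}

/-- The growth time `inf {t ≥ 0 : #C(t) = n}`, with `inf ∅ = ∞`. -/
noncomputable def growTime (α : ℝ) (u : Vertex d → ℝ) (n : ℕ) : ℝ≥0∞ :=
  ⨅ (t : ℝ≥0) (_ : (cluster α u t).encard = n), (t : ℝ≥0∞)

/-- The time `T(∞)` to percolate to infinity, the limit of the growth times as `n → ∞`. It is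
written as a lower limit, which is the limit wherever the limit exists (almost surely, in the
model with independent exponential variables, where the growth times are nondecreasing). -/
noncomputable def percTime (α : ℝ) (u : Vertex d → ℝ) : ℝ≥0∞ :=
  liminf (growTime α u) atTop

end TreeDLA

/-!
Write `q t` for the probability that the cluster `C(t)` is finite. In an environment with positive
values, a finite cluster stays constant until its next jump, which adds finitely many vertices; so
`T(∞) > t` holds exactly if `C(t)` is finite (`lt_percTime_iff`), and the claim is a bound of
`𝔼[#C(t) ^ 2; #C(t) < ∞]` by a multiple of `q t`. It is deduced from a stronger fact: for some `z > 1`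
the generating function `G t = 𝔼[z ^ #C(t); #C(t) < ∞]` is at most `3 * q t` for all `t ≥ 0`.

Splitting the tree at the root, whose subtrees are independent copies of the tree run at speed
`α⁻¹`, gives the integral equation

  `exp t * G t = 1 + z * ∫ w in 0..t, exp w * G (w / α) ^ d`,

and `q` is the case `z = 1`. If only clusters of bounded height are admitted, the equation becomes a
recursion in the height (`genFun_zero`, `genFun_succ`), so that every bounded supersolution of the
equation bounds `G` from above (`genFun_le`).

A supersolution close to `q` is obtained from the linearised equation. The density
`g t = -q' t = q t - q (t / α) ^ d` of `T(∞)` satisfies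

  `α * exp t * g t = ∫ w in 0..t, exp w * (d * q (w / α) ^ (d - 1) * g (w / α))`,

which is the differentiated equation for `q` (`integral_density`): the positive function `g` is an
eigenfunction of the linearised operator, and its eigenvalue `α` is less than one. Hence
`ψ = q + ε * (g + δ * q)` is a supersolution for `z` slightly larger than one. For small `t` the term
`δ * q` suffices, as the linearised operator is small there. For other `t` the errors, of
order `ε * δ` in `exp t * ψ t`, are paid for by the spectral gap `1 - α`, provided that `exp t * g t` is
bounded below and `exp t * q t` is bounded above. The first holds since `exp t * g t` is
nondecreasing (`exp_mul_density_mono`) and positive for `t > 0` (`density_pos`), the second by comparison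
of `q` with the supersolution `min 1 (exp (r - t))` for large `r` (`exists_survival_le`).
-/

namespace TreeDLA

variable {d : ℕ} {α : ℝ} {u : Vertex d → ℝ}

/-! ### Passage times and clusters -/

/-- The environment seen from the `i`-th child of the root. -/
def subtree (u : Vertex d → ℝ) (i : Fin d) : Vertex d → ℝ := fun x => u (i :: x)

lemma passageTime_nil : passageTime α u [] = u [] := by simp [passageTime]

lemma passageTime_cons (i : Fin d) (x : Vertex d) :
    passageTime α u (i :: x) = u [] + α * passageTime α (subtree u i) x := by
  rw [passageTime, List.length_cons, Finset.sum_range_succ', passageTime, Finset.mul_sum, add_comm]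
  congr 1
  · simp
  · exact Finset.sum_congr rfl fun k _ => by simp [subtree, pow_succ']; ring

lemma passageTime_take {x : Vertex d} {m : ℕ} (hm : m ≤ x.length) :
    passageTime α u (x.take m) = ∑ k ∈ Finset.range (m + 1), α ^ k * u (x.take k) := by
  rw [passageTime, List.length_take, min_eq_left hm]
  refine Finset.sum_congr rfl fun k hk => ?_
  rw [List.take_take, min_eq_left (Nat.lt_succ_iff.1 (Finset.mem_range.1 hk))]

lemma passageTime_take_le (hα : 0 < α) (hu : ∀ x, 0 ≤ u x) (x : Vertex d) (m : ℕ) :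
    passageTime α u (x.take m) ≤ passageTime α u x := by
  rcases le_total m x.length with hm | hm
  · rw [passageTime_take hm, passageTime]
    refine Finset.sum_le_sum_of_subset_of_nonneg (by simpa using hm) fun k _ _ => ?_
    have := hu (x.take k)
    positivity
  · rw [List.take_of_length_le hm]

lemma passageTime_take_lt (hα : 0 < α) (hu : ∀ x, 0 < u x) {x : Vertex d} {m : ℕ}
    (hm : m < x.length) : passageTime α u (x.take m) < passageTime α u x := by
  rw [passageTime_take hm.le, passageTime]
  refine Finset.sum_lt_sum_of_subset (i := m + 1) (by simpa using hm.le) (by simpa using hm)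
    (by simp) ?_ fun k _ _ => ?_
  · have := hu (x.take (m + 1))
    positivity
  · have := hu (x.take k)
    positivity

lemma root_le_passageTime (hα : 0 < α) (hu : ∀ x, 0 ≤ u x) (x : Vertex d) :
    u [] ≤ passageTime α u x := by
  simpa [passageTime_nil] using passageTime_take_le hα hu x 0

lemma cluster_mono {s t : ℝ} (h : s ≤ t) : cluster α u s ⊆ cluster α u t :=
  fun _ hx => le_trans hx h

lemma cluster_eq_empty (hα : 0 < α) (hu : ∀ x, 0 ≤ u x) {t : ℝ} (ht : t < u []) :
    cluster α u t = ∅ :=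
  Set.eq_empty_of_forall_notMem fun x hx =>
    (ht.trans_le (root_le_passageTime hα hu x)).not_ge hx

lemma nil_mem_cluster {t : ℝ} : [] ∈ cluster α u t ↔ u [] ≤ t := by
  simp [cluster, passageTime_nil]

lemma cons_mem_cluster (hα : 0 < α) {t : ℝ} {i : Fin d} {x : Vertex d} :
    i :: x ∈ cluster α u t ↔ x ∈ cluster α (subtree u i) ((t - u []) / α) := by
  simp only [cluster, Set.mem_ofPred_eq, passageTime_cons, le_div_iff₀ hα]
  constructor <;> intro h <;> linarith

lemma cluster_eq_insert (hα : 0 < α) {t : ℝ} (ht : u [] ≤ t) :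
    cluster α u t =
      insert [] (⋃ i, List.cons i '' cluster α (subtree u i) ((t - u []) / α)) := by
  ext x
  cases x with
  | nil => simp [nil_mem_cluster, ht]
  | cons i x => simp [cons_mem_cluster hα]

lemma ncard_cluster (hα : 0 < α) {t : ℝ} (ht : u [] ≤ t)
    (hfin : ∀ i, (cluster α (subtree u i) ((t - u []) / α)).Finite) :
    (cluster α u t).ncard =
      ∑ i, (cluster α (subtree u i) ((t - u []) / α)).ncard + 1 := by
  have hf : ∀ i, (List.cons i '' cluster α (subtree u i) ((t - u []) / α)).Finite :=
    fun i => (hfin i).image _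
  rw [cluster_eq_insert hα ht, Set.ncard_insert_of_notMem (by simp) (Set.finite_iUnion hf)]
  congr 1
  rw [← finsum_eq_sum_of_fintype, Set.ncard_iUnion_of_finite hf]
  · congr 1
    ext i
    exact Set.ncard_image_of_injective _ (List.cons_injective)
  · intro i j hij
    rw [Function.onFun, Set.disjoint_left]
    rintro _ ⟨x, -, rfl⟩ ⟨y, -, h⟩
    exact hij (List.cons.inj h).1.symm

/-- A finite cluster stays constant for a while and then makes a jump by finitely many vertices:
the next jump time is the least passage time over the finite outer boundary of the cluster. -/
lemma exists_next_jump (hd : 1 ≤ d) (hα : 0 < α) (hu : ∀ x, 0 < u x) {s : ℝ}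
    (hs : (cluster α u s).Finite) :
    ∃ s' > s, (cluster α u s').Finite ∧ cluster α u s ⊂ cluster α u s' ∧
      (∀ r < s', cluster α u r ⊆ cluster α u s) := by
  set C := cluster α u s with hC
  set B : Set (Vertex d) := {x | x ∉ C ∧ ∀ m < x.length, x.take m ∈ C} with hB
  have hBfin : B.Finite := by
    refine ((hs.prod (Set.finite_univ (α := Fin d))).image
      (fun p : Vertex d × Fin d => p.1 ++ [p.2])).insert [] |>.subset ?_
    rintro x ⟨-, hx⟩
    rcases x.eq_nil_or_concat with rfl | ⟨y, i, rfl⟩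
    · simp
    · right
      exact ⟨(y, i), ⟨by simpa using hx y.length (by simp), Set.mem_univ _⟩, by simp⟩
  have hanc : ∀ x ∉ C, ∃ m ≤ x.length, x.take m ∈ B := by
    classical
    intro x hx
    have hex : ∃ m, x.take m ∉ C := ⟨x.length, by simpa using hx⟩
    have hle : Nat.find hex ≤ x.length := Nat.find_min' hex (by simpa using hx)
    refine ⟨Nat.find hex, hle, Nat.find_spec hex, fun m hm => ?_⟩
    rw [List.length_take, min_eq_left hle] at hm
    rw [List.take_take, min_eq_left hm.le]
    exact not_not.1 (Nat.find_min hex hm)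
  have : Nonempty (Fin d) := ⟨⟨0, hd⟩⟩
  obtain ⟨x₀, hx₀⟩ : ∃ x, x ∉ C := hs.exists_notMem
  obtain ⟨m₀, -, hm₀⟩ := hanc x₀ hx₀
  obtain ⟨b, hbB, hb⟩ := Set.exists_min_image B (passageTime α u) hBfin ⟨_, hm₀⟩
  have hsb : s < passageTime α u b := not_le.1 hbB.1
  refine ⟨passageTime α u b, hsb, (hs.union hBfin).subset fun x hx => ?_, ?_, fun r hr x hx => ?_⟩
  · by_contra hxn
    rw [Set.mem_union, not_or] at hxn
    obtain ⟨m, hm, hmB⟩ := hanc x hxn.1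
    rcases hm.eq_or_lt with rfl | hm
    · exact hxn.2 (by simpa using hmB)
    · exact ((hb _ hmB).trans_lt (passageTime_take_lt hα hu hm)).not_ge hx
  · exact (Set.ssubset_iff_of_subset (cluster_mono hsb.le)).2 ⟨b, le_refl (passageTime α u b), hbB.1⟩
  · by_contra hxn
    obtain ⟨m, -, hmB⟩ := hanc x hxn
    exact ((hb _ hmB).trans (passageTime_take_le hα (fun y => (hu y).le) x m)).not_gt
      (lt_of_le_of_lt hx hr)

/-- In a positive environment, percolation to infinity has not happened by time `t` exactly if the
cluster at time `t` is finite. -/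
lemma lt_percTime_iff (hd : 1 ≤ d) (hα : 0 < α) (hu : ∀ x, 0 < u x) (t : ℝ≥0) :
    (t : ℝ≥0∞) < percTime α u ↔ (cluster α u t).Finite := by
  constructor
  · intro h
    by_contra hinf
    obtain ⟨N, hN⟩ := eventually_atTop.1 (eventually_lt_of_lt_liminf h)
    -- Up to time `t`, finite clusters have fewer than `N` vertices, so that there is a largest one,
    -- and it grows at its next jump.
    have hlt : ∀ s : ℝ≥0, s ≤ t → (cluster α u s).Finite → (cluster α u s).ncard < N := by
      intro s hst hs
      by_contra hcard
      refine (hN _ (not_lt.1 hcard)).not_ge ?_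
      exact (iInf₂_le s hs.cast_ncard_eq.symm).trans (by exact_mod_cast hst)
    -- The cluster at time `0` is empty, hence finite.
    have hne : ∃ n, ∃ s : ℝ≥0, s ≤ t ∧ (cluster α u s).Finite ∧
        N - (cluster α u s).ncard = n := by
      refine ⟨_, 0, zero_le, ?_, rfl⟩
      rw [NNReal.coe_zero, cluster_eq_empty hα (fun y => (hu y).le) (hu [])]
      exact Set.finite_empty
    classical
    obtain ⟨s, hst, hs, hcard⟩ := Nat.find_spec hne
    obtain ⟨s', hss', hs'fin, hssub, hconst⟩ := exists_next_jump hd hα hu hs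
    have hs't : s' ≤ t := by
      by_contra hlt'
      exact hinf (hs.subset (hconst t (not_le.1 hlt')))
    have hs'0 : 0 ≤ s' := s.coe_nonneg.trans hss'.le
    have h1 := Set.ncard_lt_ncard hssub hs'fin
    have h2 := hlt ⟨s', hs'0⟩ hs't hs'fin
    have h3 := Nat.find_min' hne ⟨⟨s', hs'0⟩, hs't, hs'fin, rfl⟩
    change (cluster α u s').ncard < N at h2
    change _ ≤ N - (cluster α u s').ncard at h3
    omega
  · intro hfin
    obtain ⟨s', hss', hs'fin, hssub, hconst⟩ := exists_next_jump hd hα hu hfin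
    have hs'0 : 0 ≤ s' := t.coe_nonneg.trans hss'.le
    lift s' to ℝ≥0 using hs'0
    have hlt : (t : ℝ≥0∞) < s' := by
      rw [ENNReal.coe_lt_coe]; exact_mod_cast hss'
    refine hlt.trans_le (le_liminf_of_le (by isBoundedDefault) ?_)
    filter_upwards [eventually_gt_atTop (cluster α u t).ncard] with n hn
    refine le_iInf₂ fun r hr => ?_
    rw [ENNReal.coe_le_coe]
    by_contra hlt'
    have hsub := hconst r (by exact_mod_cast not_le.1 hlt')
    have := Set.ncard_le_ncard hsub hfin
    rw [Set.ncard, hr, ENat.toNat_natCast] at this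
    omega

/-! ### A recursive weight -/

/-- `weight α z n t u` is `z ^ #C(t)` if the cluster `C(t)` has no vertex of generation `n` or
later, and `0` otherwise (see `weight_eq`). It is defined by recursion over the tree: after the
root gets wet at time `u []`, the subtrees of its children are independent copies of the whole
tree, with time running faster by the factor `α⁻¹`. -/
noncomputable def weight (α : ℝ) (z : ℝ≥0∞) : ℕ → ℝ → (Vertex d → ℝ) → ℝ≥0∞
  | 0, t, u => if t < u [] then 1 else 0
  | n + 1, t, u => if t < u [] then 1 else z * ∏ i, weight α z n ((t - u []) / α) (subtree u i)

lemma finite_of_length_lt {C : Set (Vertex d)} {n : ℕ} (h : ∀ x ∈ C, x.length < n) : C.Finite :=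
  (List.finite_length_lt (Fin d) n).subset h

open Classical in
lemma weight_eq (hα : 0 < α) (z : ℝ≥0∞) (n : ℕ) (t : ℝ) (hu : ∀ x, 0 ≤ u x) :
    weight α z n t u =
      if ∀ x ∈ cluster α u t, x.length < n then z ^ (cluster α u t).ncard else 0 := by
  induction n generalizing t u with
  | zero =>
    rw [weight]
    by_cases ht : t < u []
    · simp [ht, cluster_eq_empty hα hu ht]
    · rw [if_neg ht, if_neg]
      exact fun h => absurd (h [] (nil_mem_cluster.2 (not_lt.1 ht))) (by simp)
  | succ n ih =>
    rw [weight]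
    by_cases ht : t < u []
    · simp [ht, cluster_eq_empty hα hu ht]
    · have ht' := not_lt.1 ht
      rw [if_neg ht]
      simp only [ih _ (u := subtree u _) (fun x => hu _)]
      have hiff : (∀ x ∈ cluster α u t, x.length < n + 1) ↔
          ∀ i, ∀ x ∈ cluster α (subtree u i) ((t - u []) / α), x.length < n := by
        constructor
        · intro h i x hx
          simpa using h (i :: x) ((cons_mem_cluster hα).2 hx)
        · intro h x hx
          cases x with
          | nil => simp
          | cons i x => simpa using h i x ((cons_mem_cluster hα).1 hx)
      by_cases hall : ∀ x ∈ cluster α u t, x.length < n + 1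
      · have hall' := hiff.1 hall
        rw [if_pos hall, ncard_cluster hα ht' fun i => finite_of_length_lt (hall' i), pow_succ',
          ← Finset.prod_pow_eq_pow_sum]
        congr 1
        exact Finset.prod_congr rfl fun i _ => if_pos (hall' i)
      · rw [if_neg hall]
        rw [hiff, not_forall] at hall
        obtain ⟨i, hi⟩ := hall
        rw [Finset.prod_eq_zero (Finset.mem_univ i) (if_neg hi), mul_zero]

lemma weight_mono (hα : 0 < α) (z : ℝ≥0∞) (t : ℝ) (hu : ∀ x, 0 ≤ u x) :
    Monotone fun n => weight α z n t u := by
  intro m n hmn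
  simp only [weight_eq hα z _ t hu]
  split_ifs with h1 h2
  · exact le_rfl
  · exact absurd (fun x hx => (h1 x hx).trans_le hmn) h2
  · exact zero_le
  · exact le_rfl

open Classical in
/-- The weights increase to `z ^ #C(t)` on the event that the cluster is finite. -/
lemma iSup_weight (hα : 0 < α) (z : ℝ≥0∞) (t : ℝ) (hu : ∀ x, 0 ≤ u x) :
    ⨆ n, weight α z n t u =
      if (cluster α u t).Finite then z ^ (cluster α u t).ncard else 0 := by
  simp only [weight_eq hα z _ t hu]
  split_ifs with hfin
  · obtain ⟨N, hN⟩ := (hfin.image List.length).bddAbove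
    refine le_antisymm (iSup_le fun n => by split_ifs <;> simp) (le_iSup_of_le (N + 1) ?_)
    rw [if_pos fun x hx => Nat.lt_succ_iff.2 (hN ⟨x, hx, rfl⟩)]
  · simp only [ENNReal.iSup_eq_zero]
    exact fun n => if_neg fun h => hfin (finite_of_length_lt h)

@[fun_prop]
lemma measurable_subtree (i : Fin d) : Measurable fun u : Vertex d → ℝ => subtree u i :=
  measurable_pi_iff.2 fun x => measurable_pi_apply (i :: x)

lemma measurable_weight (z : ℝ≥0∞) (n : ℕ) :
    Measurable fun p : ℝ × (Vertex d → ℝ) => weight α z n p.1 p.2 := by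
  have hroot : Measurable fun p : ℝ × (Vertex d → ℝ) => p.2 [] := by fun_prop
  have hset : MeasurableSet {p : ℝ × (Vertex d → ℝ) | p.1 < p.2 []} :=
    measurableSet_lt measurable_fst hroot
  induction n with
  | zero => exact Measurable.ite hset measurable_const measurable_const
  | succ n ih =>
    refine Measurable.ite hset measurable_const (Measurable.const_mul
      (Finset.measurable_prod _ fun i _ => ?_) z)
    exact ih.comp (Measurable.prodMk ((measurable_fst.sub hroot).div_const α)
      ((measurable_subtree i).comp measurable_snd))

lemma measurable_weight_right (z : ℝ≥0∞) (n : ℕ) (t : ℝ) :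
    Measurable fun u : Vertex d → ℝ => weight α z n t u :=
  (measurable_weight z n).comp measurable_prodMk_left

/-! ### The exponential distribution -/

instance : IsProbabilityMeasure (expMeasure 1) := isProbabilityMeasure_expMeasure one_pos

lemma expMeasure_Iic {t : ℝ} (ht : 0 ≤ t) :
    expMeasure 1 (Set.Iic t) = ENNReal.ofReal (1 - Real.exp (-t)) := by
  have := lintegral_exponentialPDF_eq_antiDeriv one_pos t
  rw [if_pos ht, one_mul] at this
  rw [← this]
  exact withDensity_apply _ measurableSet_Iic

lemma expMeasure_Ioi {t : ℝ} (ht : 0 ≤ t) :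
    expMeasure 1 (Set.Ioi t) = ENNReal.ofReal (Real.exp (-t)) := by
  rw [← Set.compl_Iic, prob_compl_eq_one_sub measurableSet_Iic, expMeasure_Iic ht,
    ← ENNReal.ofReal_one, ← ENNReal.ofReal_sub _ (by simpa using ht)]
  congr 1
  ring

lemma ae_expMeasure_pos : ∀ᵐ a ∂(expMeasure 1), 0 < a := by
  have h : expMeasure 1 (Set.Iic 0) = 0 := by simp [expMeasure_Iic le_rfl]
  filter_upwards [measure_eq_zero_iff_ae_notMem.1 h] with a ha
  simpa using ha

/-- The expectation, over the exponential time `a` at which the root gets wet, of a quantity which is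
`1` before that time and depends on the elapsed time `t - a` afterwards. -/
lemma lintegral_expMeasure_ite {f : ℝ → ℝ} (hf : Measurable f) (hf0 : ∀ x, 0 ≤ f x) {C : ℝ}
    (hfC : ∀ x, f x ≤ C) {t : ℝ} (ht : 0 ≤ t) :
    ∫⁻ a, (if t < a then 1 else ENNReal.ofReal (f (t - a))) ∂(expMeasure 1) =
      ENNReal.ofReal (Real.exp (-t) * (1 + ∫ w in (0)..t, Real.exp w * f w)) := by
  have hset : MeasurableSet (Set.Ioi t) := measurableSet_Ioi
  have hmeas : Measurable fun a => ENNReal.ofReal (f (t - a)) := by fun_prop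
  have hsub : ∫ w in (0)..t, Real.exp w * f w =
      Real.exp t * ∫ a in (0)..t, Real.exp (-a) * f (t - a) := by
    rw [← intervalIntegral.integral_const_mul]
    have := intervalIntegral.integral_comp_sub_left (a := 0) (b := t)
      (fun w => Real.exp w * f w) t
    rw [sub_self, sub_zero] at this
    rw [← this]
    congr 1
    ext a
    rw [← mul_assoc, ← Real.exp_add]
    ring_nf
  have hI0 : 0 ≤ ∫ a in (0)..t, Real.exp (-a) * f (t - a) :=
    intervalIntegral.integral_nonneg ht fun a _ => mul_nonneg (Real.exp_pos _).le (hf0 _)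
  have hright : ∫⁻ a in Set.Ioi t, (if t < a then 1 else ENNReal.ofReal (f (t - a)))
      ∂(expMeasure 1) = ENNReal.ofReal (Real.exp (-t)) := by
    rw [setLIntegral_congr_fun (g := fun _ => 1) hset fun a (ha : t < a) => if_pos ha, setLIntegral_one,
      expMeasure_Ioi ht]
  have hleft : ∫⁻ a in (Set.Ioi t)ᶜ, (if t < a then 1 else ENNReal.ofReal (f (t - a)))
      ∂(expMeasure 1) = ENNReal.ofReal (∫ a in (0)..t, Real.exp (-a) * f (t - a)) := by
    rw [setLIntegral_congr_fun (g := fun a => ENNReal.ofReal (f (t - a))) hset.compl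
      fun a (ha : ¬ t < a) => if_neg ha, Set.compl_Ioi]
    have hpdf : Measurable (exponentialPDF 1) := (measurable_exponentialPDFReal 1).ennreal_ofReal
    change ∫⁻ a in Set.Iic t, ENNReal.ofReal (f (t - a))
      ∂(volume.withDensity (exponentialPDF 1)) = _
    rw [setLIntegral_withDensity_eq_setLIntegral_mul _ hpdf hmeas measurableSet_Iic,
      lintegral_Iic_eq_lintegral_Iio_add_Icc _ ht]
    have h0 : ∫⁻ a in Set.Iio 0, (exponentialPDF 1 * fun a => ENNReal.ofReal (f (t - a))) a = 0 := by
      rw [setLIntegral_congr_fun (g := fun _ => 0) measurableSet_Iio, lintegral_zero]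
      intro a ha
      simp [exponentialPDF_of_neg ha]
    rw [h0, zero_add, intervalIntegral.integral_of_le ht, ← integral_Icc_eq_integral_Ioc,
      ofReal_integral_eq_lintegral_ofReal]
    · refine setLIntegral_congr_fun measurableSet_Icc fun a ha => ?_
      simp only [Pi.mul_apply, exponentialPDF_of_nonneg ha.1, one_mul]
      rw [ENNReal.ofReal_mul (Real.exp_pos _).le]
    · refine Measure.integrableOn_of_bounded (M := C) (by simp) (by fun_prop) ?_
      refine (ae_restrict_iff' measurableSet_Icc).2 (Eventually.of_forall fun a ha => ?_)
      rw [Real.norm_of_nonneg (mul_nonneg (Real.exp_pos _).le (hf0 _))]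
      exact (mul_le_of_le_one_left (hf0 _) (by simpa using ha.1)).trans (hfC _)
    · exact Eventually.of_forall fun a => mul_nonneg (Real.exp_pos _).le (hf0 _)
  rw [← lintegral_add_compl _ hset, hright, hleft, ← ENNReal.ofReal_add (Real.exp_pos _).le hI0,
    hsub]
  congr 1
  rw [mul_add, ← mul_assoc, ← Real.exp_add]
  simp

/-! ### The law of the environment -/

/-- The law of a family of independent mean one exponential variables indexed by the tree. -/
noncomputable def envLaw (d : ℕ) : Measure (Vertex d → ℝ) :=
  Measure.infinitePi fun _ => expMeasure 1

instance : IsProbabilityMeasure (envLaw d) := by unfold envLaw; infer_instance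

lemma ae_envLaw_pos : ∀ᵐ u ∂(envLaw d), ∀ x, 0 < u x := by
  refine ae_all_iff.2 fun x => ?_
  have h := ae_expMeasure_pos
  rw [← Measure.infinitePi_map_eval (fun _ : Vertex d => expMeasure 1) x] at h
  exact ae_of_ae_map (measurable_pi_apply x).aemeasurable h

/-- The environment with value `p.1` at the root and the environments `p.2 i` in the subtrees. -/
def graft (p : ℝ × (Fin d → Vertex d → ℝ)) : Vertex d → ℝ
  | [] => p.1
  | i :: x => p.2 i x

lemma measurable_graft : Measurable (graft (d := d)) := by
  refine measurable_pi_iff.2 fun x => ?_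
  cases x with
  | nil => exact measurable_fst
  | cons i x => exact (measurable_pi_apply x).comp ((measurable_pi_apply i).comp measurable_snd)

open Classical in
/-- A product over vertices splits into the root and the subtrees of its children. -/
lemma prod_vertex {M : Type*} [CommMonoid M] (s : Finset (Vertex d)) (f : Vertex d → M) :
    ∏ x ∈ s, f x = (if [] ∈ s then f [] else 1) *
      ∏ i, ∏ x ∈ s.preimage (List.cons i) (List.cons_injective.injOn), f (i :: x) := by
  rw [← Finset.prod_fiberwise s (fun x => x.head?) f, Fintype.prod_option]
  congr 1
  · have : s.filter (fun x => x.head? = none) = if [] ∈ s then {[]} else ∅ := by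
      ext x
      split_ifs with h <;> cases x <;> simp [h]
    rw [this]
    split_ifs <;> simp
  · refine Finset.prod_congr rfl fun i _ => ?_
    rw [Finset.prod_preimage' (List.cons i) s (List.cons_injective.injOn) f]
    congr 1
    ext x
    cases x with
    | nil => simp
    | cons j x => simp [eq_comm]

/-- The root variable and the environments of the subtrees are independent, and each subtree is a
copy of the whole tree. -/
lemma map_graft :
    ((expMeasure 1).prod (Measure.pi fun _ : Fin d => envLaw d)).map graft = envLaw d := by
  classical
  refine Measure.eq_infinitePi _ fun s t ht => ?_
  rw [Measure.map_apply measurable_graft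
    (MeasurableSet.pi s.countable_toSet fun x _ => ht x), prod_vertex]
  have hpre : graft ⁻¹' (Set.pi s t) = (if [] ∈ s then t [] else Set.univ) ×ˢ
      Set.univ.pi fun i : Fin d =>
        Set.pi (s.preimage (List.cons i) (List.cons_injective.injOn)) fun x => t (i :: x) := by
    ext p
    simp only [Set.mem_preimage, Set.mem_pi, Set.mem_prod, Set.mem_univ, true_implies,
      Finset.mem_coe, Finset.mem_preimage]
    constructor
    · intro h
      refine ⟨?_, fun i x hx => h (i :: x) hx⟩
      split_ifs with h0
      · exact h [] h0
      · trivial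
    · rintro ⟨h1, h2⟩ x hx
      cases x with
      | nil => rw [if_pos hx] at h1; exact h1
      | cons i x => exact h2 i x hx
  rw [hpre, Measure.prod_prod, Measure.pi_pi]
  congr 1
  · split_ifs <;> simp
  · exact Finset.prod_congr rfl fun i _ => Measure.infinitePi_pi _ fun x _ => ht _

/-! ### Generating functions of the cluster size -/

/-- The expectation of `z ^ #C(t)` over the event that the cluster has no vertex of generation `n`
or later. -/
noncomputable def genFun (d : ℕ) (α : ℝ) (z : ℝ≥0∞) (n : ℕ) (t : ℝ) : ℝ≥0∞ :=
  ∫⁻ u, weight α z n t u ∂(envLaw d)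

lemma measurable_genFun (z : ℝ≥0∞) (n : ℕ) : Measurable (genFun d α z n) :=
  (measurable_weight z n).lintegral_prod_right'

lemma lintegral_envLaw {F : (Vertex d → ℝ) → ℝ≥0∞} (hF : Measurable F) :
    ∫⁻ u, F u ∂(envLaw d) =
      ∫⁻ a, ∫⁻ v, F (graft (a, v)) ∂(Measure.pi fun _ : Fin d => envLaw d) ∂(expMeasure 1) := by
  conv_lhs => rw [← map_graft, lintegral_map hF measurable_graft]
  exact lintegral_prod _ (hF.comp measurable_graft).aemeasurable

lemma genFun_zero (z : ℝ≥0∞) (t : ℝ) :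
    genFun d α z 0 t = ∫⁻ a, (if t < a then 1 else 0) ∂(expMeasure 1) := by
  rw [genFun, lintegral_envLaw (measurable_weight_right z 0 t)]
  refine lintegral_congr fun a => ?_
  change ∫⁻ _, (if t < a then 1 else 0) ∂_ = _
  rw [lintegral_const, measure_univ, mul_one]

lemma lintegral_pi_prod {F : (Vertex d → ℝ) → ℝ≥0∞} (hF : Measurable F) :
    ∫⁻ v, ∏ i, F (v i) ∂(Measure.pi fun _ : Fin d => envLaw d) =
      (∫⁻ u, F u ∂(envLaw d)) ^ d := by
  have hind : iIndepFun (fun (i : Fin d) (v : Fin d → Vertex d → ℝ) => F (v i))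
      (Measure.pi fun _ : Fin d => envLaw d) :=
    iIndepFun_pi (X := fun _ => F) fun _ => hF.aemeasurable
  rw [lintegral_prod_eq_prod_lintegral_of_indepFun _ _ hind
    fun i => hF.comp (measurable_pi_apply i)]
  have h (i : Fin d) : ∫⁻ v, F (v i) ∂(Measure.pi fun _ : Fin d => envLaw d) =
      ∫⁻ u, F u ∂(envLaw d) :=
    (measurePreserving_eval (fun _ : Fin d => envLaw d) i).lintegral_comp hF
  simp [h]

lemma genFun_succ (z : ℝ≥0∞) (n : ℕ) (t : ℝ) :
    genFun d α z (n + 1) t =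
      ∫⁻ a, (if t < a then 1 else z * genFun d α z n ((t - a) / α) ^ d) ∂(expMeasure 1) := by
  rw [genFun, lintegral_envLaw (measurable_weight_right z _ t)]
  refine lintegral_congr fun a => ?_
  have hsub (v : Fin d → Vertex d → ℝ) (i : Fin d) : subtree (graft (a, v)) i = v i := rfl
  simp only [weight, hsub, graft]
  split_ifs with h
  · simp
  · have hm := measurable_weight_right (d := d) (α := α) z n ((t - a) / α)
    rw [lintegral_const_mul, lintegral_pi_prod hm]
    · rfl
    · exact Finset.measurable_prod _ fun i _ => hm.comp (measurable_pi_apply i)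

/-- A supersolution of the integral equation of the generating function bounds it from above. -/
lemma genFun_le (hα : 0 < α) {z : ℝ} (hz : 0 ≤ z) {ψ : ℝ → ℝ} (hψ : Continuous ψ)
    (hψ0 : ∀ t, 0 ≤ ψ t) {C : ℝ} (hψC : ∀ t, ψ t ≤ C)
    (hsup : ∀ t, 0 ≤ t → 1 + ∫ w in (0)..t, Real.exp w * (z * ψ (w / α) ^ d) ≤
      Real.exp t * ψ t) (n : ℕ) {t : ℝ} (ht : 0 ≤ t) :
    genFun d α (ENNReal.ofReal z) n t ≤ ENNReal.ofReal (ψ t) := by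
  have key : ∀ t, 0 ≤ t →
      ∫⁻ a, (if t < a then 1 else ENNReal.ofReal (z * ψ ((t - a) / α) ^ d)) ∂(expMeasure 1) ≤
        ENNReal.ofReal (ψ t) := by
    intro t ht
    rw [lintegral_expMeasure_ite (f := fun w => z * ψ (w / α) ^ d) (C := z * C ^ d)
      (by fun_prop) (fun w => by have := hψ0 (w / α); positivity) (fun w => ?_) ht]
    · refine ENNReal.ofReal_le_ofReal ?_
      rw [Real.exp_neg, inv_mul_le_iff₀ (Real.exp_pos t)]
      exact hsup t ht
    · have := pow_le_pow_left₀ (hψ0 (w / α)) (hψC (w / α)) d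
      gcongr
  cases n with
  | zero =>
    rw [genFun_zero]
    refine (lintegral_mono fun a => ?_).trans (key t ht)
    split_ifs <;> simp
  | succ n =>
    rw [genFun_succ]
    refine (lintegral_mono fun a => ?_).trans (key t ht)
    by_cases h : t < a
    · simp [h]
    · rw [if_neg h, if_neg h, ENNReal.ofReal_mul hz, ENNReal.ofReal_pow (hψ0 _)]
      gcongr
      exact genFun_le hα hz hψ hψ0 hψC hsup n (div_nonneg (sub_nonneg.2 (not_lt.1 h)) hα.le)

lemma iSup_genFun (hα : 0 < α) (z : ℝ≥0∞) (t : ℝ) :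
    ⨆ n, genFun d α z n t = ∫⁻ u, ⨆ n, weight α z n t u ∂(envLaw d) := by
  refine (lintegral_iSup' (fun n => ?_) ?_).symm
  · exact (measurable_weight_right z n t).aemeasurable
  · filter_upwards [ae_envLaw_pos] with u hu
    exact weight_mono hα z t fun x => (hu x).le

lemma genFun_mono (hα : 0 < α) (z : ℝ≥0∞) (t : ℝ) : Monotone fun n => genFun d α z n t := by
  intro m n hmn
  refine lintegral_mono_ae ?_
  filter_upwards [ae_envLaw_pos] with u hu
  exact weight_mono hα z t (fun x => (hu x).le) hmn

/-! ### The probability that the cluster is finite -/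

/-- The probability that the cluster at time `t` is finite, that is, that percolation to infinity
takes longer than `t`. -/
noncomputable def survival (d : ℕ) (α t : ℝ) : ℝ := (⨆ n, genFun d α 1 n t).toReal

lemma iSup_genFun_one_le (hα : 0 < α) (t : ℝ) : ⨆ n, genFun d α 1 n t ≤ 1 := by
  classical
  rw [iSup_genFun hα]
  refine (lintegral_mono_ae (g := fun _ => 1) ?_).trans (by simp)
  filter_upwards [ae_envLaw_pos] with u hu
  rw [iSup_weight hα _ _ fun x => (hu x).le]
  split_ifs <;> simp

lemma ofReal_survival (hα : 0 < α) (t : ℝ) :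
    ENNReal.ofReal (survival d α t) = ⨆ n, genFun d α 1 n t :=
  ENNReal.ofReal_toReal ((iSup_genFun_one_le hα t).trans_lt ENNReal.one_lt_top).ne

lemma survival_nonneg (t : ℝ) : 0 ≤ survival d α t := ENNReal.toReal_nonneg

lemma survival_le_one (hα : 0 < α) (t : ℝ) : survival d α t ≤ 1 := by
  simpa [survival] using ENNReal.toReal_mono ENNReal.one_ne_top (iSup_genFun_one_le (d := d) hα t)

lemma survival_antitone (hα : 0 < α) : Antitone (survival d α) := by
  classical
  intro s t hst
  rw [← ENNReal.ofReal_le_ofReal_iff (survival_nonneg s), ofReal_survival hα, ofReal_survival hα,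
    iSup_genFun hα, iSup_genFun hα]
  refine lintegral_mono_ae ?_
  filter_upwards [ae_envLaw_pos] with u hu
  rw [iSup_weight hα _ _ fun x => (hu x).le, iSup_weight hα _ _ fun x => (hu x).le]
  split_ifs with h1 h2
  · simp
  · exact absurd (h1.subset (cluster_mono hst)) h2
  · simp
  · simp

/-- The integral equation of the survival function. -/
lemma exp_mul_survival (hα : 0 < α) {t : ℝ} (ht : 0 ≤ t) :
    Real.exp t * survival d α t =
      1 + ∫ w in (0)..t, Real.exp w * survival d α (w / α) ^ d := by
  have hlim : Tendsto (fun n => genFun d α 1 (n + 1) t) atTop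
      (nhds (⨆ n, genFun d α 1 n t)) :=
    (tendsto_atTop_iSup (genFun_mono hα 1 t)).comp (tendsto_add_atTop_nat 1)
  have hle (n : ℕ) (s : ℝ) : genFun d α 1 n s ≤ 1 :=
    (le_iSup (fun n => genFun d α 1 n s) n).trans (iSup_genFun_one_le hα s)
  have hlim' : Tendsto (fun n => genFun d α 1 (n + 1) t) atTop
      (nhds (∫⁻ a, (if t < a then 1 else ENNReal.ofReal (survival d α ((t - a) / α) ^ d))
        ∂(expMeasure 1))) := by
    simp only [genFun_succ]
    refine tendsto_lintegral_of_dominated_convergence (fun _ => 1) (fun n => ?_) (fun n => ?_)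
      (by simp) (Eventually.of_forall fun a => ?_)
    · refine Measurable.ite measurableSet_Ioi measurable_const (Measurable.const_mul
        (Measurable.pow_const ?_ _) _)
      exact (measurable_genFun 1 n).comp (by fun_prop)
    · refine Eventually.of_forall fun a => ?_
      beta_reduce
      split_ifs
      · exact le_rfl
      · rw [one_mul]
        exact pow_le_one' (hle _ _) _
    · split_ifs
      · exact tendsto_const_nhds
      · rw [ENNReal.ofReal_pow (survival_nonneg _), ofReal_survival hα]
        simp only [one_mul]
        exact ((ENNReal.continuous_pow d).tendsto _).comp
          (tendsto_atTop_iSup (genFun_mono hα 1 _))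
  have heq := tendsto_nhds_unique hlim hlim'
  have hm : Measurable (survival d α) := (survival_antitone hα).measurable
  rw [lintegral_expMeasure_ite (f := fun w => survival d α (w / α) ^ d) (C := 1) (by fun_prop)
    (fun w => pow_nonneg (survival_nonneg _) _)
    (fun w => pow_le_one₀ (survival_nonneg _) (survival_le_one hα _)) ht,
    ← ofReal_survival hα, ENNReal.ofReal_eq_ofReal_iff (survival_nonneg _)] at heq
  · rw [heq, ← mul_assoc, ← Real.exp_add]
    simp
  · have : 0 ≤ ∫ w in (0)..t, Real.exp w * survival d α (w / α) ^ d :=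
      intervalIntegral.integral_nonneg ht fun w _ =>
        mul_nonneg (Real.exp_pos _).le (pow_nonneg (survival_nonneg _) _)
    positivity

/-! ### Regularity of the survival function -/

lemma survival_of_nonpos (hα : 0 < α) {t : ℝ} (ht : t ≤ 0) : survival d α t = 1 := by
  refine le_antisymm (survival_le_one hα t) ?_
  have h := exp_mul_survival (d := d) hα le_rfl
  simp only [Real.exp_zero, one_mul, intervalIntegral.integral_same, add_zero] at h
  exact h ▸ survival_antitone hα ht

lemma exp_neg_le_survival (hα : 0 < α) {t : ℝ} (ht : 0 ≤ t) :
    Real.exp (-t) ≤ survival d α t := by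
  rw [Real.exp_neg, inv_le_iff_one_le_mul₀' (Real.exp_pos t), exp_mul_survival hα ht]
  refine le_add_of_nonneg_right (intervalIntegral.integral_nonneg ht fun w _ => ?_)
  exact mul_nonneg (Real.exp_pos _).le (pow_nonneg (survival_nonneg _) _)

lemma survival_pos (hα : 0 < α) (t : ℝ) : 0 < survival d α t := by
  rcases le_total t 0 with ht | ht
  · simp [survival_of_nonpos hα ht]
  · exact (Real.exp_pos _).trans_le (exp_neg_le_survival hα ht)

lemma continuous_survival (hα : 0 < α) : Continuous (survival d α) := by
  have hm : Measurable (survival d α) := (survival_antitone hα).measurable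
  have hint : ∀ a b, IntervalIntegrable
      (fun w => Real.exp w * survival d α (w / α) ^ d) volume a b := by
    intro a b
    refine (Real.continuous_exp.intervalIntegrable a b).mono_fun (by fun_prop) ?_
    refine Eventually.of_forall fun w => ?_
    have h0 := survival_nonneg (d := d) (α := α) (w / α)
    beta_reduce
    rw [norm_mul, Real.norm_of_nonneg (pow_nonneg h0 d)]
    exact mul_le_of_le_one_right (norm_nonneg _) (pow_le_one₀ h0 (survival_le_one hα _))
  have hcont := intervalIntegral.continuous_primitive hint 0
  have heq : survival d α = fun t => Real.exp (-(max t 0)) *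
      (1 + ∫ w in (0)..(max t 0), Real.exp w * survival d α (w / α) ^ d) := by
    ext t
    rw [← exp_mul_survival hα (le_max_right t 0), ← mul_assoc, ← Real.exp_add, neg_add_cancel,
      Real.exp_zero, one_mul]
    rcases le_total t 0 with ht | ht
    · rw [max_eq_right ht, survival_of_nonpos hα ht, survival_of_nonpos hα le_rfl]
    · rw [max_eq_left ht]
  rw [heq]
  have hmax : Continuous fun t : ℝ => max t 0 := by fun_prop
  exact (Real.continuous_exp.comp hmax.neg).mul (continuous_const.add (hcont.comp hmax))

/-- The density of the time to percolate to infinity. -/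
noncomputable def density (d : ℕ) (α t : ℝ) : ℝ := survival d α t - survival d α (t / α) ^ d

lemma continuous_density (hα : 0 < α) : Continuous (density d α) := by
  have := continuous_survival (d := d) hα
  unfold density
  fun_prop

lemma density_le_survival (t : ℝ) : density d α t ≤ survival d α t :=
  sub_le_self _ (pow_nonneg (survival_nonneg _) _)

lemma density_nonneg (hd : 1 ≤ d) (hα : 0 < α) (hα1 : α < 1) (t : ℝ) : 0 ≤ density d α t := by
  refine sub_nonneg.2 ?_
  refine (pow_le_of_le_one (survival_nonneg _) (survival_le_one hα _) (by omega)).trans ?_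
  rcases le_total t 0 with ht | ht
  · rw [survival_of_nonpos hα ht]
    exact survival_le_one hα _
  · exact survival_antitone hα (le_div_self ht hα hα1.le)

lemma hasDerivAt_survival (hα : 0 < α) {t : ℝ} (ht : 0 < t) :
    HasDerivAt (survival d α) (-density d α t) t := by
  have hc := continuous_survival (d := d) hα
  have hF : Continuous fun w => Real.exp w * survival d α (w / α) ^ d := by fun_prop
  have h1 : HasDerivAt (fun t => Real.exp (-t)) (-Real.exp (-t)) t := by
    simpa using (hasDerivAt_neg t).exp
  have h2 := (hF.integral_hasStrictDerivAt 0 t).hasDerivAt.const_add 1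
  have h3 := h1.mul h2
  refine (h3.congr_of_eventuallyEq ?_).congr_deriv ?_
  · filter_upwards [eventually_gt_nhds ht] with s hs
    simp only [Pi.mul_apply]
    rw [← exp_mul_survival hα hs.le, ← mul_assoc, ← Real.exp_add, neg_add_cancel, Real.exp_zero,
      one_mul]
  · rw [← exp_mul_survival hα ht.le, ← mul_assoc, neg_mul, neg_mul, ← mul_assoc, ← Real.exp_add,
      neg_add_cancel, Real.exp_zero, density]
    ring

/-- Differentiating the integral equation of the survival function: the density is an eigenfunction
of the linearised equation, with eigenvalue `α < 1`. -/
lemma hasDerivAt_exp_mul_density (hα : 0 < α) {t : ℝ} (ht : 0 < t) :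
    HasDerivAt (fun t => α * (Real.exp t * density d α t))
      (Real.exp t * (d * survival d α (t / α) ^ (d - 1) * density d α (t / α))) t := by
  have h1 := hasDerivAt_survival (d := d) hα ht
  have h2 : HasDerivAt (fun t => survival d α (t / α)) (-density d α (t / α) * (1 / α)) t :=
    HasDerivAt.comp (h₂ := survival d α) (h := fun t => t / α) t
      (hasDerivAt_survival hα (div_pos ht hα)) ((hasDerivAt_id' t).div_const α)
  refine (((Real.hasDerivAt_exp t).mul (h1.sub (h2.pow d))).const_mul α).congr_deriv ?_
  simp only [Pi.sub_apply, Pi.pow_apply]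
  rw [← density]
  field_simp
  ring

lemma integral_density (hα : 0 < α) {t : ℝ} (ht : 0 ≤ t) :
    ∫ w in (0)..t, Real.exp w * (d * survival d α (w / α) ^ (d - 1) * density d α (w / α)) =
      α * (Real.exp t * density d α t) := by
  have hc := continuous_survival (d := d) hα
  have hg := continuous_density (d := d) hα
  rw [intervalIntegral.integral_eq_sub_of_hasDerivAt_of_le
    (f := fun t => α * (Real.exp t * density d α t)) ht (by fun_prop)
    (fun w hw => hasDerivAt_exp_mul_density hα hw.1)
    (Continuous.intervalIntegrable (by fun_prop) _ _)]
  simp [density, survival_of_nonpos hα le_rfl]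

lemma exp_mul_density_mono (hd : 1 ≤ d) (hα : 0 < α) (hα1 : α < 1) {s t : ℝ} (hs : 0 ≤ s)
    (hst : s ≤ t) : Real.exp s * density d α s ≤ Real.exp t * density d α t := by
  have hc := continuous_survival (d := d) hα
  have hg := continuous_density (d := d) hα
  refine le_of_mul_le_mul_left ?_ hα
  rw [← integral_density hα hs, ← integral_density hα (hs.trans hst)]
  refine intervalIntegral.integral_mono_interval le_rfl hs hst ?_
    (Continuous.intervalIntegrable (by fun_prop) _ _)
  refine Eventually.of_forall fun w => ?_
  have h1 := survival_nonneg (d := d) (α := α) (w / α)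
  have h2 := density_nonneg hd hα hα1 (w / α)
  simp only [Pi.zero_apply]
  positivity

/-! ### Exponential decay of the survival function -/

/-- The time to percolate to infinity has an exponential tail of the same rate as the passage time
of the root. -/
lemma exists_survival_le (hd : 1 ≤ d) (hα : 0 < α) (hα1 : α < 1) :
    ∃ M : ℝ, 0 < M ∧ ∀ t, 0 ≤ t → Real.exp t * survival d α t ≤ M := by
  -- Interpolation exponent `θ ∈ (α, 1)`: `min 1 (exp x) ≤ exp (θ x)`.
  set θ : ℝ := (1 + α) / 2 with hθ
  have hθ1 : θ < 1 := by rw [hθ]; linarith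
  have hθα : α < θ := by rw [hθ]; linarith
  set κ : ℝ := θ / α - 1 with hκ
  have hκ0 : 0 < κ := by rw [hκ, sub_pos, one_lt_div hα]; exact hθα
  obtain ⟨r, hr0, hr⟩ : ∃ r : ℝ, 0 ≤ r ∧ 1 + Real.exp (θ * r) / κ ≤ Real.exp r := by
    have h1 : Tendsto (fun r : ℝ => Real.exp (-r) + Real.exp (-((1 - θ) * r)) / κ) atTop
        (nhds (0 + 0 / κ)) := by
      refine Real.tendsto_exp_neg_atTop_nhds_zero.add (Tendsto.div_const ?_ κ)
      exact Real.tendsto_exp_neg_atTop_nhds_zero.comp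
        (tendsto_id.const_mul_atTop (sub_pos.2 hθ1))
    rw [zero_div, add_zero] at h1
    obtain ⟨r, hr, hr0⟩ :=
      ((h1.eventually_le_const one_pos).and (eventually_ge_atTop 0)).exists
    refine ⟨r, hr0, ?_⟩
    have h2 := mul_le_mul_of_nonneg_left hr (Real.exp_pos r).le
    rw [mul_add, ← mul_div_assoc, ← Real.exp_add, ← Real.exp_add, mul_one, add_neg_cancel,
      Real.exp_zero] at h2
    rwa [show θ * r = r + -((1 - θ) * r) by ring]
  set ψ : ℝ → ℝ := fun t => min 1 (Real.exp (r - t)) with hψ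
  have hψc : Continuous ψ := by fun_prop
  have hψ0 (t : ℝ) : 0 ≤ ψ t := le_min zero_le_one (Real.exp_pos _).le
  have hψ1 (t : ℝ) : ψ t ≤ 1 := min_le_left _ _
  have hsup : ∀ t, 0 ≤ t → 1 + ∫ w in (0)..t, Real.exp w * (1 * ψ (w / α) ^ d) ≤
      Real.exp t * ψ t := by
    intro t ht
    simp only [one_mul]
    rcases le_total t r with htr | htr
    · have h1 : ψ t = 1 := min_eq_left (by simpa using htr)
      have h2 : ∫ w in (0)..t, Real.exp w * ψ (w / α) ^ d ≤ ∫ w in (0)..t, Real.exp w := by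
        refine intervalIntegral.integral_mono_on ht
          (Continuous.intervalIntegrable (by fun_prop) _ _)
          (Continuous.intervalIntegrable (by fun_prop) _ _) fun w _ => ?_
        exact mul_le_of_le_one_right (Real.exp_pos _).le (pow_le_one₀ (hψ0 _) (hψ1 _))
      rw [integral_exp, Real.exp_zero] at h2
      rw [h1]
      linarith
    · have h1 : Real.exp t * ψ t = Real.exp r := by
        rw [hψ]
        beta_reduce
        rw [min_eq_right (by simpa using htr), ← Real.exp_add, add_sub_cancel]
      have h2 : ∫ w in (0)..t, Real.exp w * ψ (w / α) ^ d ≤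
          ∫ w in (0)..t, Real.exp (θ * r) * Real.exp (-κ * w) := by
        refine intervalIntegral.integral_mono_on ht
          (Continuous.intervalIntegrable (by fun_prop) _ _)
          (Continuous.intervalIntegrable (by fun_prop) _ _) fun w _ => ?_
        have h3 : ψ (w / α) ≤ Real.exp (θ * (r - w / α)) := by
          rcases le_total 0 (r - w / α) with h | h
          · exact (min_le_left _ _).trans (Real.one_le_exp (by positivity))
          · exact (min_le_right _ _).trans (Real.exp_le_exp.2 (by nlinarith))
        calc Real.exp w * ψ (w / α) ^ d ≤ Real.exp w * Real.exp (θ * (r - w / α)) := by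
              gcongr
              exact (pow_le_of_le_one (hψ0 _) (hψ1 _) (by omega)).trans h3
          _ = Real.exp (θ * r) * Real.exp (-κ * w) := by
              rw [← Real.exp_add, ← Real.exp_add, hκ]
              congr 1
              field_simp
              ring
      have h4 : ∫ w in (0)..t, Real.exp (θ * r) * Real.exp (-κ * w) ≤ Real.exp (θ * r) / κ := by
        rw [intervalIntegral.integral_const_mul, div_eq_mul_inv]
        gcongr
        rw [intervalIntegral.integral_comp_mul_left (fun x => Real.exp x) (neg_ne_zero.2 hκ0.ne'),
          integral_exp, smul_eq_mul, mul_zero, Real.exp_zero, inv_neg, neg_mul, ← mul_neg]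
        refine mul_le_of_le_one_right (inv_pos.2 hκ0).le ?_
        have := Real.exp_pos (-κ * t)
        linarith
      rw [h1]
      linarith
  refine ⟨Real.exp r, Real.exp_pos r, fun t ht => ?_⟩
  have h5 : survival d α t ≤ ψ t := by
    rw [← ENNReal.ofReal_le_ofReal_iff (hψ0 t), ofReal_survival hα]
    refine iSup_le fun n => ?_
    simpa using genFun_le hα zero_le_one hψc hψ0 hψ1 hsup n ht
  calc Real.exp t * survival d α t ≤ Real.exp t * Real.exp (r - t) := by
        gcongr
        exact h5.trans (min_le_right _ _)
    _ = Real.exp r := by rw [← Real.exp_add, add_sub_cancel]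

/-- If the density vanished at `t > 0`, it would vanish at `t / α ^ n` for all `n`, and the survival
function would not decrease along this sequence. -/
lemma density_pos (hd : 1 ≤ d) (hα : 0 < α) (hα1 : α < 1) {t : ℝ} (ht : 0 < t) :
    0 < density d α t := by
  refine (density_nonneg hd hα hα1 t).lt_of_ne' fun h0 => ?_
  have hpos (n : ℕ) : 0 < t / α ^ n := by positivity
  have hstep (n : ℕ) : t / α ^ (n + 1) = t / α ^ n / α := by rw [pow_succ, div_div]
  have hzero (n : ℕ) : density d α (t / α ^ n) = 0 := by
    induction n with
    | zero => simpa using h0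
    | succ n ih =>
      have hmin : IsLocalMin (fun t => α * (Real.exp t * density d α t)) (t / α ^ n) := by
        refine Eventually.of_forall fun s => ?_
        beta_reduce
        rw [ih, mul_zero, mul_zero]
        have := density_nonneg hd hα hα1 s
        positivity
      have h := hmin.hasDerivAt_eq_zero (hasDerivAt_exp_mul_density hα (hpos n))
      have h1 := survival_pos (d := d) hα (t / α ^ n / α)
      have h2 : (d : ℝ) ≠ 0 := by positivity
      rw [← hstep] at h h1
      simpa [h1.ne', h2] using h
  have hle (n : ℕ) : survival d α t ≤ survival d α (t / α ^ n) := by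
    induction n with
    | zero => simp
    | succ n ih =>
      have h := hzero n
      rw [density, sub_eq_zero, ← hstep] at h
      rw [h] at ih
      exact ih.trans (pow_le_of_le_one (survival_nonneg _) (survival_le_one hα _) (by omega))
  obtain ⟨M, hM, hbd⟩ := exists_survival_le hd hα hα1
  have hlim : Tendsto (fun n : ℕ => t / α ^ n) atTop atTop := by
    have := (tendsto_pow_atTop_atTop_of_one_lt (one_lt_inv_iff₀.2 ⟨hα, hα1⟩)).const_mul_atTop ht
    simpa [div_eq_mul_inv] using this
  obtain ⟨n, hn⟩ := ((Real.tendsto_exp_atTop.comp hlim).eventually_gt_atTop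
    (M / survival d α t)).exists
  have hq := survival_pos (d := d) hα t
  rw [Function.comp_apply, div_lt_iff₀ hq] at hn
  refine hn.not_ge (le_trans ?_ (hbd _ (hpos n).le))
  gcongr
  exact hle n

/-! ### A supersolution above the survival function -/

lemma one_add_pow_le {y : ℝ} (hy : 0 ≤ y) (hdy : d * y ≤ 1) :
    (1 + y) ^ d ≤ 1 + d * y + (d * y) ^ 2 := by
  have h0 : 0 ≤ d * y := by positivity
  have h1 : (1 + y) ^ d ≤ Real.exp (d * y) := by
    rw [Real.exp_nat_mul]
    gcongr
    linarith [Real.add_one_le_exp y]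
  have h2 := (abs_le.1 (Real.abs_exp_sub_one_sub_id_le (abs_le.2 ⟨by linarith, hdy⟩))).2
  linarith

/-- The arithmetic behind the supersolution. Here `A` and `G` stand for `exp t` times the survival
function and the density at time `t`. -/
lemma supersolution_arith {α D t A G M γ δ ε : ℝ} (hα : 0 < α) (hα1 : α < 1) (hD : 1 ≤ D)
    (hA1 : 1 ≤ A) (hAe : A ≤ Real.exp t) (hAM : A ≤ M) (hM : 0 < M) (hγ : 0 < γ) (hG0 : 0 ≤ G)
    (hG : 1 / (2 * D + 2) ≤ t → γ ≤ G)
    (hδ : δ = min ((1 - α) / 2) ((1 - α) * γ / (4 * M * (D + 1))))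
    (hε : ε = δ / (8 * D ^ 2)) :
    1 + (1 + ε * δ) * ((1 + D * ε * δ + 4 * D ^ 2 * ε ^ 2) * (A - 1) + ε * (α * G)) ≤
      A + ε * (G + δ * A) := by
  have hδ0 : 0 < δ := by
    rw [hδ]
    have : 0 < 1 - α := by linarith
    positivity
  have hε0 : 0 < ε := by rw [hε]; positivity
  have hδ1 : δ ≤ (1 - α) / 2 := hδ ▸ min_le_left _ _
  have hδ2 : δ ≤ (1 - α) * γ / (4 * M * (D + 1)) := hδ ▸ min_le_right _ _
  have hεD : 8 * D ^ 2 * ε = δ := by rw [hε]; field_simp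
  have hε1 : ε ≤ 1 := by nlinarith
  have hη : ε * δ ≤ (1 - α) / 2 := by nlinarith
  have hη1 : ε * δ ≤ 1 := by linarith
  have hX0 : 0 ≤ D * ε * δ + 4 * D ^ 2 * ε ^ 2 := by positivity
  -- The errors from `z > 1`, from `δ`, and from the quadratic terms in `ε` are all of order `ε * δ`.
  have hlin : (1 + ε * δ) * (1 + D * ε * δ + 4 * D ^ 2 * ε ^ 2) - 1 ≤
      ε * δ * (2 * D + 2) := by
    have h1 : ε * δ * (D * ε * δ + 4 * D ^ 2 * ε ^ 2) ≤ D * ε * δ + 4 * D ^ 2 * ε ^ 2 :=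
      mul_le_of_le_one_left hX0 hη1
    have h2 : 8 * D ^ 2 * ε ^ 2 = ε * δ := by rw [← hεD]; ring
    nlinarith
  have hlinA := mul_le_mul_of_nonneg_right hlin (sub_nonneg.2 hA1)
  have hz : (1 + ε * δ) * α ≤ (1 + α) / 2 := by nlinarith
  have hzG := mul_le_mul_of_nonneg_right hz (mul_nonneg hε0.le hG0)
  suffices hs : ε * δ * (2 * D + 2) * (A - 1) ≤ (1 - α) / 2 * (ε * G) + ε * δ * A by
    nlinarith
  have hεG : 0 ≤ (1 - α) / 2 * (ε * G) :=
    mul_nonneg (by linarith) (mul_nonneg hε0.le hG0)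
  have hεδ : 0 < ε * δ := mul_pos hε0 hδ0
  rcases lt_or_ge t (1 / (2 * D + 2)) with ht | ht
  · -- For small times the root is rarely wet, and the constant part of the supersolution suffices.
    have h1 : (2 * D + 2) * t ≤ 1 := by
      rw [lt_div_iff₀ (by positivity)] at ht
      linarith
    have h2 : A * (1 - t) ≤ 1 := by
      have h3 : A * Real.exp (-t) ≤ 1 := by
        rw [Real.exp_neg, mul_inv_le_iff₀ (Real.exp_pos t), one_mul]
        exact hAe
      refine le_trans ?_ h3
      gcongr
      linarith [Real.add_one_le_exp (-t)]
    have h4 : (2 * D + 2) * (A - 1) ≤ A := by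
      have h5 : A - 1 ≤ A * t := by linarith
      calc (2 * D + 2) * (A - 1) ≤ (2 * D + 2) * (A * t) := by gcongr
        _ = A * ((2 * D + 2) * t) := by ring
        _ ≤ A := mul_le_of_le_one_right (by linarith) h1
    have h6 := mul_le_mul_of_nonneg_left h4 hεδ.le
    linarith
  · -- For large times the gap `1 - α` in the eigenvalue of the density pays for the errors.
    have h1 : δ * ((2 * D + 2) * M) ≤ (1 - α) / 2 * G := by
      rw [le_div_iff₀ (by positivity)] at hδ2
      have h2 : (1 - α) / 2 * γ ≤ (1 - α) / 2 * G :=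
        mul_le_mul_of_nonneg_left (hG ht) (by linarith)
      linarith
    have h3 : δ * ((2 * D + 2) * (A - 1)) ≤ δ * ((2 * D + 2) * M) := by
      gcongr
      linarith
    have h4 := mul_le_mul_of_nonneg_left (h3.trans h1) hε0.le
    have h5 : 0 ≤ ε * δ * A := by positivity
    linarith

/-- The function `ψ` in the proof is a supersolution for the parameter `1 + η` with `η = ε * δ`. Hence
the generating function of the cluster size is comparable to the survival function, uniformly
in time, for some parameter larger than one. -/
lemma exists_genFun_le (hd : 1 ≤ d) (hα : 0 < α) (hα1 : α < 1) :
    ∃ η : ℝ, 0 < η ∧ ∀ n, ∀ t, 0 ≤ t →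
      genFun d α (ENNReal.ofReal (1 + η)) n t ≤ ENNReal.ofReal (3 * survival d α t) := by
  obtain ⟨M, hM, hAM⟩ := exists_survival_le hd hα hα1
  have hD : (1 : ℝ) ≤ d := by exact_mod_cast hd
  set t₀ : ℝ := 1 / (2 * d + 2) with ht₀
  have ht₀0 : 0 < t₀ := by positivity
  set γ : ℝ := Real.exp t₀ * density d α t₀ with hγdef
  have hγ : 0 < γ := mul_pos (Real.exp_pos _) (density_pos hd hα hα1 ht₀0)
  set δ : ℝ := min ((1 - α) / 2) ((1 - α) * γ / (4 * M * (d + 1))) with hδ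
  set ε : ℝ := δ / (8 * (d : ℝ) ^ 2) with hε
  have hα0' : 0 < 1 - α := by linarith
  have hδ0 : 0 < δ := by positivity
  have hδ1 : δ ≤ 1 := by linarith [min_le_left ((1 - α) / 2) ((1 - α) * γ / (4 * M * (d + 1)))]
  have hε0 : 0 < ε := by positivity
  have hεd : 8 * (d : ℝ) ^ 2 * ε ≤ 1 := by
    have : 8 * (d : ℝ) ^ 2 * ε = δ := by rw [hε]; field_simp
    rw [this]
    exact hδ1
  have hdε : 2 * (d * ε) ≤ 1 := by nlinarith
  have hε1 : 2 * ε ≤ 1 := by nlinarith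
  have hq := continuous_survival (d := d) hα
  have hg := continuous_density (d := d) hα
  have hq0 := survival_pos (d := d) hα
  have hq1 := survival_le_one (d := d) hα
  have hg0 := density_nonneg hd hα hα1
  have hgq := density_le_survival (d := d) (α := α)
  set ψ : ℝ → ℝ := fun t => survival d α t + ε * (density d α t + δ * survival d α t) with hψ
  have hψc : Continuous ψ := by fun_prop
  have hψ0 (t : ℝ) : 0 ≤ ψ t := by
    have h1 := hq0 t
    have h2 := hg0 t
    positivity
  have hψ3 (t : ℝ) : ψ t ≤ 3 * survival d α t := by
    have h1 : density d α t + δ * survival d α t ≤ 2 * survival d α t := by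
      nlinarith [hgq t, hq0 t]
    have h2 := mul_le_mul_of_nonneg_left h1 hε0.le
    simp only [hψ]
    nlinarith [hq0 t]
  have hpow (s : ℝ) : ψ s ^ d ≤
      (1 + d * ε * δ + 4 * d ^ 2 * ε ^ 2) * survival d α s ^ d +
        ε * (d * survival d α s ^ (d - 1) * density d α s) := by
    set q := survival d α s with hqs
    set g := density d α s with hgs
    have hqs0 : 0 < q := hq0 s
    have h0 : 0 ≤ g / q := div_nonneg (hg0 s) hqs0.le
    have h1 : g / q ≤ 1 := (div_le_one hqs0).2 (hgq s)
    have h2 : ψ s = q * (1 + ε * (g / q + δ)) := by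
      simp only [hψ, ← hqs, ← hgs]
      field_simp
    have hy0 : 0 ≤ ε * (g / q + δ) := by positivity
    have hy2 : d * (ε * (g / q + δ)) ≤ 2 * (d * ε) := by
      have : (d * ε) * (g / q + δ) ≤ (d * ε) * 2 := by gcongr; linarith
      linarith
    have h3 := one_add_pow_le hy0 (hy2.trans hdε)
    have h4 : (d * (ε * (g / q + δ))) ^ 2 ≤ (2 * (d * ε)) ^ 2 := by gcongr
    have h5 : q ^ d = q ^ (d - 1) * q := by rw [← pow_succ]; congr 1; omega
    rw [h2, mul_pow]
    calc q ^ d * (1 + ε * (g / q + δ)) ^ d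
        ≤ q ^ d * (1 + d * (ε * (g / q + δ)) + (2 * (d * ε)) ^ 2) := by
          gcongr
          linarith
      _ = (1 + d * ε * δ + 4 * d ^ 2 * ε ^ 2) * q ^ d + ε * (d * (q ^ d * (g / q))) := by ring
      _ = _ := by
          rw [h5]
          field_simp
  refine ⟨ε * δ, mul_pos hε0 hδ0, fun n t ht => ?_⟩
  refine (genFun_le hα (by positivity) hψc hψ0 (C := 3) (fun t => ?_) (fun t ht => ?_) n ht).trans
    (ENNReal.ofReal_le_ofReal (hψ3 t))
  · linarith [hψ3 t, hq1 t]
  · have hA := exp_mul_survival (d := d) hα ht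
    have hA1 : 1 ≤ Real.exp t * survival d α t := by
      have := mul_le_mul_of_nonneg_left (exp_neg_le_survival (d := d) hα ht) (Real.exp_pos t).le
      rwa [← Real.exp_add, add_neg_cancel, Real.exp_zero] at this
    have hAe : Real.exp t * survival d α t ≤ Real.exp t :=
      mul_le_of_le_one_right (Real.exp_pos t).le (hq1 t)
    have harith := supersolution_arith (G := Real.exp t * density d α t) hα hα1 hD hA1 hAe
      (hAM t ht) hM hγ (mul_nonneg (Real.exp_pos t).le (hg0 t))
      (fun h => exp_mul_density_mono hd hα hα1 ht₀0.le h) hδ hε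
    have hint : ∫ w in (0)..t, Real.exp w * ((1 + ε * δ) * ψ (w / α) ^ d) ≤
        ∫ w in (0)..t, (1 + ε * δ) * ((1 + d * ε * δ + 4 * d ^ 2 * ε ^ 2) *
          (Real.exp w * survival d α (w / α) ^ d) +
          ε * (Real.exp w *
            (d * survival d α (w / α) ^ (d - 1) * density d α (w / α)))) := by
      refine intervalIntegral.integral_mono_on ht
        (Continuous.intervalIntegrable (by fun_prop) _ _)
        (Continuous.intervalIntegrable (by fun_prop) _ _) fun w _ => ?_
      have h1 : 0 ≤ Real.exp w * (1 + ε * δ) := by positivity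
      have h2 := mul_le_mul_of_nonneg_left (hpow (w / α)) h1
      linarith
    rw [intervalIntegral.integral_const_mul, intervalIntegral.integral_add
      (Continuous.intervalIntegrable (by fun_prop) _ _)
      (Continuous.intervalIntegrable (by fun_prop) _ _),
      intervalIntegral.integral_const_mul, intervalIntegral.integral_const_mul,
      integral_density hα ht, ← sub_eq_iff_eq_add'.2 hA] at hint
    refine (add_le_add_right hint 1).trans (harith.trans_eq ?_)
    simp only [hψ]
    ring

/-! ### The second moment of the cluster size -/

lemma exists_sq_le_mul_pow {η : ℝ} (hη : 0 < η) :
    ∃ K : ℝ, 0 < K ∧ ∀ n : ℕ, (n : ℝ) ^ 2 ≤ K * (1 + η) ^ n := by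
  have h := tendsto_pow_const_div_const_pow_of_one_lt 2 (r := 1 + η) (by linarith)
  obtain ⟨K, hK⟩ := h.bddAbove_range
  refine ⟨max K 1, by positivity, fun n => ?_⟩
  have h1 := (hK ⟨n, rfl⟩).trans (le_max_left K 1)
  have h2 : 0 < (1 + η) ^ n := by positivity
  rwa [div_le_iff₀ h2] at h1

/-- The event that the cluster is finite. It is described through the weights, which makes its
measurability immediate; the two agree in positive environments (see `mem_finiteEvent`). -/
def finiteEvent (d : ℕ) (α t : ℝ) : Set (Vertex d → ℝ) := {u | ⨆ n, weight α 1 n t u = 1}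

lemma measurableSet_finiteEvent (t : ℝ) : MeasurableSet (finiteEvent d α t) :=
  (Measurable.iSup fun n => measurable_weight_right 1 n t) (measurableSet_singleton 1)

lemma mem_finiteEvent (hα : 0 < α) {u : Vertex d → ℝ} (hu : ∀ x, 0 < u x) (t : ℝ) :
    u ∈ finiteEvent d α t ↔ (cluster α u t).Finite := by
  classical
  rw [finiteEvent, Set.mem_ofPred_eq, iSup_weight hα _ _ fun x => (hu x).le]
  split_ifs with h <;> simp [h]

lemma envLaw_finiteEvent (hα : 0 < α) (t : ℝ) :
    envLaw d (finiteEvent d α t) = ENNReal.ofReal (survival d α t) := by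
  classical
  rw [ofReal_survival hα, iSup_genFun hα, ← lintegral_indicator_one (measurableSet_finiteEvent t)]
  refine lintegral_congr_ae ?_
  filter_upwards [ae_envLaw_pos] with u hu
  have h := mem_finiteEvent hα hu t
  rw [iSup_weight hα _ _ fun x => (hu x).le, Set.indicator_apply]
  simp [h]

end TreeDLA

theorem theorem4p6 (d : ℕ) (hd : 1 ≤ d) (α : ℝ) (hα0 : 0 < α) (hα1 : α < 1) :
    ∃ c : ℝ, 0 < c ∧
      ∀ (Ω : Type*) [MeasurableSpace Ω] (μ : Measure Ω) [IsProbabilityMeasure μ]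
        (U : TreeDLA.Vertex d → Ω → ℝ),
        (∀ x, HasLaw (U x) (expMeasure 1) μ) → iIndepFun U μ →
        ∀ t : ℝ≥0,
          0 < μ {ω | (t : ℝ≥0∞) < TreeDLA.percTime α (fun x => U x ω)} ∧
          ∫⁻ ω, ((TreeDLA.cluster α (fun x => U x ω) t).encard : ℝ≥0∞) ^ 2
              ∂μ[|{ω | (t : ℝ≥0∞) < TreeDLA.percTime α (fun x => U x ω)}]
            ≤ ENNReal.ofReal c := by
  classical
  obtain ⟨η, hη, hgen⟩ := TreeDLA.exists_genFun_le hd hα0 hα1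
  obtain ⟨K, hK, hsq⟩ := TreeDLA.exists_sq_le_mul_pow hη
  refine ⟨K * 3, by positivity, fun Ω _ μ _ U hU hind t => ?_⟩
  set X : Ω → TreeDLA.Vertex d → ℝ := fun ω x => U x ω with hX
  have hXm : AEMeasurable X μ := aemeasurable_pi_iff.2 fun x => (hU x).aemeasurable
  have hmap : μ.map X = TreeDLA.envLaw d := by
    rw [hX, hind.map_fun_eq_infinitePi_map₀ hXm, TreeDLA.envLaw]
    congr 1
    ext1 x
    exact (hU x).map_eq
  have hpos : ∀ᵐ ω ∂μ, ∀ x, 0 < X ω x :=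
    ae_of_ae_map hXm (hmap ▸ TreeDLA.ae_envLaw_pos)
  set E : Set Ω := {ω | (t : ℝ≥0∞) < TreeDLA.percTime α (X ω)} with hE
  set F := TreeDLA.finiteEvent d α t with hF
  have hFm : MeasurableSet F := TreeDLA.measurableSet_finiteEvent _
  have hEF : E =ᵐ[μ] X ⁻¹' F := by
    filter_upwards [hpos] with ω hω
    have h : ω ∈ E ↔ ω ∈ X ⁻¹' F :=
      (TreeDLA.lt_percTime_iff hd hα0 hω t).trans (TreeDLA.mem_finiteEvent hα0 hω t).symm
    exact propext h
  have hμE : μ E = ENNReal.ofReal (TreeDLA.survival d α t) := by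
    rw [measure_congr hEF, ← Measure.map_apply_of_aemeasurable hXm hFm, hmap,
      TreeDLA.envLaw_finiteEvent hα0]
  have hq := TreeDLA.survival_pos (d := d) hα0 t
  have hμ0 : 0 < μ E := by rw [hμE]; exact ENNReal.ofReal_pos.2 hq
  refine ⟨hμ0, ?_⟩
  set z := ENNReal.ofReal (1 + η) with hz
  have hWm : Measurable fun u : TreeDLA.Vertex d → ℝ => ⨆ n, TreeDLA.weight α z n t u :=
    Measurable.iSup fun n => TreeDLA.measurable_weight_right z n t
  have hbound : ∫⁻ ω in E, ((TreeDLA.cluster α (X ω) t).encard : ℝ≥0∞) ^ 2 ∂μ ≤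
      ENNReal.ofReal (K * 3) * μ E := by
    calc ∫⁻ ω in E, ((TreeDLA.cluster α (X ω) t).encard : ℝ≥0∞) ^ 2 ∂μ
        = ∫⁻ ω in X ⁻¹' F, ((TreeDLA.cluster α (X ω) t).encard : ℝ≥0∞) ^ 2 ∂μ := by
          rw [Measure.restrict_congr_set hEF]
      _ ≤ ∫⁻ ω in X ⁻¹' F, ENNReal.ofReal K * ⨆ n, TreeDLA.weight α z n t (X ω) ∂μ := by
          refine lintegral_mono_ae ?_
          filter_upwards [ae_restrict_of_ae hpos,
            ae_restrict_mem₀ (hXm.nullMeasurableSet_preimage hFm)] with ω hω hmem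
          have hfin := (TreeDLA.mem_finiteEvent hα0 hω t).1 hmem
          rw [TreeDLA.iSup_weight hα0 _ _ fun x => (hω x).le, if_pos hfin, ← hfin.cast_ncard_eq,
            hz, ← ENNReal.ofReal_pow (by positivity), ← ENNReal.ofReal_mul hK.le]
          refine le_trans (le_of_eq ?_) (ENNReal.ofReal_le_ofReal (hsq _))
          rw [ENNReal.ofReal_pow (by positivity), ENNReal.ofReal_natCast]
          simp
      _ ≤ ∫⁻ ω, ENNReal.ofReal K * ⨆ n, TreeDLA.weight α z n t (X ω) ∂μ :=
          setLIntegral_le_lintegral _ _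
      _ = ENNReal.ofReal K * ∫⁻ u, ⨆ n, TreeDLA.weight α z n t u ∂(TreeDLA.envLaw d) := by
          rw [lintegral_const_mul' _ _ ENNReal.ofReal_ne_top, ← hmap,
            lintegral_map' hWm.aemeasurable hXm]
      _ ≤ ENNReal.ofReal K * ENNReal.ofReal (3 * TreeDLA.survival d α t) := by
          gcongr
          rw [← TreeDLA.iSup_genFun hα0]
          exact iSup_le fun n => hgen n t t.coe_nonneg
      _ = ENNReal.ofReal (K * 3) * μ E := by
          rw [hμE, ← ENNReal.ofReal_mul hK.le, ← ENNReal.ofReal_mul (by positivity), mul_assoc]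
  rw [ProbabilityTheory.cond, lintegral_smul_measure, smul_eq_mul]
  calc (μ E)⁻¹ * ∫⁻ ω in E, ((TreeDLA.cluster α (X ω) t).encard : ℝ≥0∞) ^ 2 ∂μ
      ≤ (μ E)⁻¹ * (ENNReal.ofReal (K * 3) * μ E) := by gcongr
    _ = ENNReal.ofReal (K * 3) := by
        rw [mul_comm, mul_assoc, ENNReal.mul_inv_cancel hμ0.ne' (measure_ne_top μ E), mul_one]
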